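/- Consider a network of $N$ identical single-input single-output subsystems with states $x_i\in\mathbb R^n$ and outputs $y_i\in\mathbb R$, $$\dot x_i = A x_i + B\Big(\alpha\sum_{j\ne i} g_{ij}(y_j-y_i)+\gamma_i w\Big),\qquad y_i = C x_i,\qquad i=1,\dots,N,$$ with coupling weights $g_{ij}\ge 0$, coupling strength $\alpha\ge 0$, and a disturbance $w$ entering at a single source $s$ ($\gamma_s=1$, $\gamma_i=0$ for $i\ne s$). The network graph has an edge from $j$ to $i$ when $g_{ij}>0$. Let $T(\sigma)=C(\sigma I-A)^{-1}B$ be the transfer function of the subsystem, and $E_i(\tau)=\int_0^\tau y_i(t)^2\,dt$ the output energies of the response of the network from zero initial state. Call a nonempty set of vertices $V_C$ a separating cutset for $s$ if the remaining vertices can be partitioned into sets $V_1$ and $V_B$ with no edge from $V_1$ to $V_B$ and $s\in V_1\cup V_C$. The network is called propagation stable if 1. its synchronization manifold $\{x_1=\dots=x_N\}$ is asymptotically stable in the sense of Lyapunov for the undisturbed network ($w=0$), and 2. for every source $s$, every disturbance $w$ that is integrable on bounded intervals (in particular, every $w$ satisfying the Dirichlet conditions), every separating cutset $V_C$ for $s$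 with a partition $V_1,V_B$ as above, every horizon $\tau>0$ and every $b\in V_B$, one has $E_b(\tau)\le\max_{c\in V_C}E_c(\tau)$. Assume that the subsystem is passive, in at least one of the following two senses: (a) $\int_0^\tau u(t)y(t)\,dt\ge 0$ for every continuous input $u$ of the subsystem $\dot x=Ax+Bu$, $y=Cx$ started at $x(0)=0$, and every $\tau\ge 0$; or (b) its Nyquist plot lies in the closed right half plane, that is, $\operatorname{Re}T(j\omega)\ge 0$ for every real $\omega$ such that $j\omega$ is not an eigenvalue of $A$. Assume also that the synchronization manifold is asymptotically stable. Then, whatever the graph, the weights $g_{ij}\ge 0$ and the coupling strength $\alpha\ge 0$, the network is propagation stable. -/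

import Mathlib

open Set Filter Topology MeasureTheory
open scoped Matrix

noncomputable section

/-- A linear time-invariant subsystem `ẋ = A x + B u`, `y = C x` with `n` states, `m` inputs and
`m` outputs. It is single-input single-output when `m = 1`. -/
structure Subsystem (n m : ℕ) where
  /-- state matrix -/
  A : Matrix (Fin n) (Fin n) ℝ
  /-- input matrix -/
  B : Matrix (Fin n) (Fin m) ℝ
  /-- output matrix -/
  C : Matrix (Fin m) (Fin n) ℝ

namespace Subsystem

variable {n m : ℕ}

/-- `x` is the solution on `[0, ∞)` of `ẋ = A x + B u`, `x 0 = x₀`, in integrated (Carathéodory)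
form, so that discontinuous inputs `u` are allowed. -/
def IsTrajectory (S : Subsystem n m) (x₀ : Fin n → ℝ) (u : ℝ → Fin m → ℝ)
    (x : ℝ → Fin n → ℝ) : Prop :=
  ContinuousOn x (Ici 0) ∧
    ∀ t : ℝ, 0 ≤ t → x t = x₀ + ∫ τ in (0 : ℝ)..t, (S.A *ᵥ x τ + S.B *ᵥ u τ)

/-- Passivity (input-output form): along every zero-state trajectory with a continuous input, the
energy `∫₀ᵀ uᵀ y dt` supplied to the subsystem up to any time `T` is nonnegative. -/
def IsPassive (S : Subsystem n m) : Prop :=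
  ∀ (u : ℝ → Fin m → ℝ) (x : ℝ → Fin n → ℝ),
    ContinuousOn u (Ici 0) → S.IsTrajectory 0 u x →
      ∀ T : ℝ, 0 ≤ T → 0 ≤ ∫ t in (0 : ℝ)..T, u t ⬝ᵥ (S.C *ᵥ x t)

/-- The transfer matrix `T(s) = C (s I - A)⁻¹ B`; meaningful when `s` is not an eigenvalue
of `A`. -/
def transfer (S : Subsystem n m) (s : ℂ) : Matrix (Fin m) (Fin m) ℂ :=
  S.C.map Complex.ofReal *
    (s • (1 : Matrix (Fin n) (Fin n) ℂ) - S.A.map Complex.ofReal)⁻¹ * S.B.map Complex.ofReal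

/-- The Nyquist plot of a single-input single-output subsystem lies in the closed right half
plane: `Re T(jω) ≥ 0` for every real `ω` such that `jω` is not an eigenvalue of `A`.
Every positive real subsystem has this property. -/
def NyquistInClosedRightHalfPlane (S : Subsystem n 1) : Prop :=
  ∀ ω : ℝ,
    ((Complex.I * (ω : ℂ)) • (1 : Matrix (Fin n) (Fin n) ℂ) - S.A.map Complex.ofReal).det ≠ 0 →
      0 ≤ (S.transfer (Complex.I * (ω : ℂ)) 0 0).re

end Subsystem

namespace Network

variable {N n m : ℕ}

/-- The coupling input `α ∑_{j ≠ i} g i j (y j - y i)` of subsystem `i`. -/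
def couplingInput (g : Matrix (Fin N) (Fin N) ℝ) (α : ℝ) (y : Fin N → Fin m → ℝ) (i : Fin N) :
    Fin m → ℝ :=
  α • ∑ j ∈ Finset.univ.erase i, g i j • (y j - y i)

/-- `x` is the trajectory, from the initial states `x₀`, of the network of `N` copies of `S` with
coupling weights `g` and coupling strength `α`, where the disturbance `d t i` enters at
subsystem `i`:
`ẋ i = A (x i) + B (α ∑_{j ≠ i} g i j (y j - y i) + d i)`, `y i = C (x i)`. -/
def IsTrajectory (S : Subsystem n m) (g : Matrix (Fin N) (Fin N) ℝ) (α : ℝ)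
    (x₀ : Fin N → Fin n → ℝ) (d : ℝ → Fin N → Fin m → ℝ) (x : ℝ → Fin N → Fin n → ℝ) : Prop :=
  ∀ i : Fin N,
    S.IsTrajectory (x₀ i) (fun t => couplingInput g α (fun j => S.C *ᵥ x t j) i + d t i)
      (fun t => x t i)

/-- The synchronization manifold: all subsystem states coincide. -/
def syncManifold (N n : ℕ) : Set (Fin N → Fin n → ℝ) :=
  {x | ∀ i j, x i = x j}

/-- The synchronization manifold of the undisturbed network is asymptotically stable in the sense
of Lyapunov: it is stable and locally attractive. -/
def SyncAsymptoticallyStable (S : Subsystem n m) (g : Matrix (Fin N) (Fin N) ℝ) (α : ℝ) : Prop :=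
  (∀ ε : ℝ, 0 < ε → ∃ δ : ℝ, 0 < δ ∧
    ∀ x₀ x, IsTrajectory S g α x₀ 0 x → Metric.infDist x₀ (syncManifold N n) < δ →
      ∀ t : ℝ, 0 ≤ t → Metric.infDist (x t) (syncManifold N n) < ε) ∧
  (∃ δ : ℝ, 0 < δ ∧
    ∀ x₀ x, IsTrajectory S g α x₀ 0 x → Metric.infDist x₀ (syncManifold N n) < δ →
      Tendsto (fun t : ℝ => Metric.infDist (x t) (syncManifold N n)) atTop (𝓝 0))

/-- The vertices are partitioned into `V₁`, `VC`, `VB` so that no edge leads from `V₁` to `VB`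
(there is an edge from `j` to `i` when `g i j > 0`) and the source `s` is in `V₁ ∪ VC`:
`VC` is a separating cutset for `s`, with `VB` the vertices beyond it. -/
def IsSeparatingCutset (g : Matrix (Fin N) (Fin N) ℝ) (s : Fin N)
    (V₁ VC VB : Finset (Fin N)) : Prop :=
  Disjoint V₁ VC ∧ Disjoint V₁ VB ∧ Disjoint VC VB ∧ V₁ ∪ VC ∪ VB = Finset.univ ∧
    (∀ j ∈ V₁, ∀ i ∈ VB, ¬ 0 < g i j) ∧ s ∈ V₁ ∪ VC

/-- The energy `E_i(T) = ∫₀ᵀ y_iᵀ y_i dt` of the output `y_i = C x_i` of subsystem `i`. -/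
def energy (S : Subsystem n m) (x : ℝ → Fin N → Fin n → ℝ) (T : ℝ) (i : Fin N) : ℝ :=
  ∫ t in (0 : ℝ)..T, (S.C *ᵥ x t i) ⬝ᵥ (S.C *ᵥ x t i)

/-- Propagation stability. The disturbance `w` enters at the single source `s`, the response is
the zero-state one, and `w` may be any signal that is integrable on bounded intervals (every
signal satisfying the Dirichlet conditions is). -/
def PropagationStable (S : Subsystem n m) (g : Matrix (Fin N) (Fin N) ℝ) (α : ℝ) : Prop :=
  SyncAsymptoticallyStable S g α ∧
    ∀ (s : Fin N) (w : ℝ → Fin m → ℝ) (x : ℝ → Fin N → Fin n → ℝ),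
      (∀ T : ℝ, 0 < T → IntervalIntegrable w volume 0 T) →
      IsTrajectory S g α 0 (fun t => Pi.single s (w t)) x →
      ∀ (V₁ VC VB : Finset (Fin N)) (hVC : VC.Nonempty), IsSeparatingCutset g s V₁ VC VB →
      ∀ T : ℝ, 0 < T → ∀ b ∈ VB, energy S x T b ≤ VC.sup' hVC (energy S x T)

end Network

end

/-! For a passive subsystem the theorem is a maximum principle for energies. At an undisturbed
vertex, passivity and `(y_j - y_i) y_i ≤ (y_j² - y_i²) / 2` give `0 ≤ ∑ α g_ij (E_j - E_i)`
(`sum_energy_sub_nonneg`). If the energy beyond the cutset exceeded its maximum on the cutset, every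
vertex of `VB` of maximal energy could be coupled only to other such vertices. That set would
receive no signal and stay at rest, so its energy would be zero, below a nonnegative energy on the
cutset.

The Nyquist condition alone says too little when the subsystem is unstable, because its signals need
not have Fourier transforms. Synchronization supplies the missing stability. A zero-sum left
eigenvector of the Laplacian, with eigenvalue `l`, combines the states into a solution of `ż = (A -
α l B C) z`; it must decay since it sees only state differences, and `Re l ≥ 0` by Gershgorin. Thus
a feedback `u = -μ y` with `Re μ ≥ 0` stabilizes the subsystem. Given an input on `[0, T]`, applying
this feedback afterwards makes all signals integrable. Parseval and the Nyquist condition make the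
total supplied energy nonnegative; the part after `T` is nonpositive, so the part on `[0, T]` is
nonnegative. -/

open scoped FourierTransform ComplexConjugate Convolution

/-! ### Linear flows: uniqueness and exponential decay -/

section LinearODE

variable {E : Type*} [NormedAddCommGroup E] [NormedSpace ℝ E]

theorem eqOn_zero_of_linear_ode (L : E →L[ℝ] E) {z : ℝ → E} (hz : ContinuousOn z (Ici 0))
    (hz' : ∀ t, 0 ≤ t → HasDerivWithinAt z (L (z t)) (Ici t) t) (h0 : z 0 = 0) :
    ∀ t, 0 ≤ t → z t = 0 := by
  intro t ht
  exact eq_zero_of_abs_deriv_le_mul_abs_self_of_eq_zero_right (a := 0) (b := t) (K := ‖L‖)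
    (hz.mono Icc_subset_Ici_self) (fun s hs => hz' s hs.1) h0
    (fun s _ => L.le_opNorm _) t ⟨ht, le_rfl⟩

theorem exp_zero_smul_apply (L : E →L[ℝ] E) (v : E) :
    NormedSpace.exp ((0 : ℝ) • L) v = v := by
  simp

variable [CompleteSpace E]

theorem hasDerivAt_exp_smul_apply (L : E →L[ℝ] E) (v : E) (t : ℝ) :
    HasDerivAt (fun s : ℝ => NormedSpace.exp (s • L) v) (L (NormedSpace.exp (t • L) v)) t := by
  have h := (hasDerivAt_exp_smul_const' (𝕂 := ℝ) L t).clm_apply (hasDerivAt_const t v)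
  simpa using h

theorem continuous_exp_smul_apply (L : E →L[ℝ] E) (v : E) :
    Continuous (fun s : ℝ => NormedSpace.exp (s • L) v) :=
  continuous_iff_continuousAt.2 fun t => (hasDerivAt_exp_smul_apply L v t).continuousAt

theorem eq_exp_smul_of_linear_ode (L : E →L[ℝ] E) {z : ℝ → E}
    (hz : ∀ t, HasDerivAt z (L (z t)) t) :
    ∀ t, 0 ≤ t → z t = NormedSpace.exp (t • L) (z 0) := by
  intro t ht
  have hd : ∀ t, HasDerivAt (fun s => z s - NormedSpace.exp (s • L) (z 0))
      (L (z t - NormedSpace.exp (t • L) (z 0))) t := fun t => by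
    rw [map_sub]
    exact (hz t).sub (hasDerivAt_exp_smul_apply L (z 0) t)
  refine sub_eq_zero.1 (eqOn_zero_of_linear_ode L
    (fun s _ => (hd s).continuousAt.continuousWithinAt)
    (fun s _ => (hd s).hasDerivWithinAt) ?_ t ht)
  simp

theorem exp_add_smul (L : E →L[ℝ] E) (s t : ℝ) :
    NormedSpace.exp ((s + t) • L) = NormedSpace.exp (s • L) * NormedSpace.exp (t • L) := by
  let _ : NormedAlgebra ℚ (E →L[ℝ] E) := NormedAlgebra.restrictScalars ℚ ℝ _
  rw [add_smul]
  exact NormedSpace.exp_add_of_commute (((Commute.refl L).smul_left s).smul_right t)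

/-- In finite dimension, a linear flow that tends to zero pointwise decays exponentially. -/
theorem exists_norm_exp_smul_le [FiniteDimensional ℝ E] (L : E →L[ℝ] E)
    (hL : ∀ v, Tendsto (fun t : ℝ => NormedSpace.exp (t • L) v) atTop (𝓝 0)) :
    ∃ K c : ℝ, 0 < c ∧ ∀ t, 0 ≤ t → ‖NormedSpace.exp (t • L)‖ ≤ K * Real.exp (-c * t) := by
  obtain ⟨C, hC, hCb⟩ := (Module.finBasis ℝ E).exists_opNorm_le (F := E)
  have hev : ∀ᶠ t : ℝ in atTop, ∀ i, ‖NormedSpace.exp (t • L) (Module.finBasis ℝ E i)‖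
      ≤ Real.exp (-1) / C := by
    refine eventually_all.2 fun i => ?_
    have := (hL (Module.finBasis ℝ E i)).norm
    rw [norm_zero] at this
    exact (this.eventually (gt_mem_nhds (by positivity))).mono fun t ht => ht.le
  obtain ⟨τ, hτ, hτ0⟩ := (hev.and (eventually_gt_atTop 0)).exists
  have hτn : ‖NormedSpace.exp (τ • L)‖ ≤ Real.exp (-1) := by
    have := hCb (by positivity) hτ
    rwa [mul_div_cancel₀ _ hC.ne'] at this
  have hcont : Continuous fun t : ℝ => NormedSpace.exp (t • L) :=
    continuous_iff_continuousAt.2 fun t => (hasDerivAt_exp_smul_const (𝕂 := ℝ) L t).continuousAt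
  obtain ⟨K, hK⟩ := (isCompact_Icc (a := (0 : ℝ)) (b := τ)).exists_bound_of_continuousOn
    hcont.continuousOn
  have hK0 : 0 ≤ K := (norm_nonneg _).trans (hK 0 ⟨le_rfl, hτ0.le⟩)
  have hstep : ∀ k : ℕ, ∀ r ∈ Icc 0 τ,
      ‖NormedSpace.exp ((k * τ + r) • L)‖ ≤ Real.exp (-1) ^ k * K := by
    intro k r hr
    induction k with
    | zero => simpa using hK r hr
    | succ k ih =>
      have : ((k + 1 : ℕ) : ℝ) * τ + r = τ + (k * τ + r) := by push_cast; ring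
      rw [this, exp_add_smul, pow_succ', mul_assoc]
      exact (norm_mul_le _ _).trans (mul_le_mul hτn ih (norm_nonneg _) (by positivity))
  -- With `t = k τ + r` and `k = ⌊t / τ⌋₊ > t / τ - 1`, the bound `exp (-k)` is at most `exp 1 * exp
  -- (-t / τ)`.
  refine ⟨Real.exp 1 * K, 1 / τ, by positivity, fun t ht => ?_⟩
  have h1 : (⌊t / τ⌋₊ : ℝ) ≤ t / τ := Nat.floor_le (by positivity)
  have h2 : t / τ < ⌊t / τ⌋₊ + 1 := Nat.lt_floor_add_one _
  have h3 : t / τ * τ = t := by field_simp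
  have h := hstep ⌊t / τ⌋₊ (t - ⌊t / τ⌋₊ * τ) ⟨by nlinarith, by nlinarith⟩
  rw [add_sub_cancel] at h
  refine h.trans ?_
  rw [← Real.exp_nat_mul, mul_right_comm, ← Real.exp_add]
  refine mul_le_mul_of_nonneg_right (Real.exp_le_exp.2 ?_) hK0
  have : -(1 / τ) * t = -(t / τ) := by ring
  rw [this]
  linarith

end LinearODE

/-! ### Fourier transform of derivatives, and a one-sided Parseval inequality -/

section Fourier

/-- The Fourier transform of the derivative, for a function that is differentiable off a countable
set. -/
theorem fourier_deriv_off_countable {E : Type*} [NormedAddCommGroup E] [NormedSpace ℂ E]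
    [CompleteSpace E] {f f' : ℝ → E} {s : Set ℝ} (hs : s.Countable) (hf : Continuous f)
    (hd : ∀ t ∉ s, HasDerivAt f (f' t) t) (hfi : Integrable f) (hfi' : Integrable f')
    (hbot : Tendsto f atBot (𝓝 0)) (htop : Tendsto f atTop (𝓝 0)) (ω : ℝ) :
    𝓕 f' ω = (2 * Real.pi * Complex.I * ω) • 𝓕 f ω := by
  set e : ℝ → ℂ := fun t => Complex.exp (((-2 * Real.pi * t * ω : ℝ) : ℂ) * Complex.I) with he
  have hed : ∀ t, HasDerivAt e (e t * (((-2 * Real.pi * 1 * ω : ℝ) : ℂ) * Complex.I)) t := by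
    intro t
    have : HasDerivAt (fun t : ℝ => -2 * Real.pi * t * ω) (-2 * Real.pi * 1 * ω) t :=
      ((hasDerivAt_id t).const_mul _).mul_const ω
    exact (this.ofReal_comp.mul_const Complex.I).cexp
  have hec : Continuous e := continuous_iff_continuousAt.2 fun t => (hed t).continuousAt
  have hen : ∀ t, ‖e t‖ = 1 := fun t => Complex.norm_exp_ofReal_mul_I _
  have hmul : ∀ {g : ℝ → E}, Integrable g → Integrable fun t => e t • g t := by
    intro g hg
    refine hg.bdd_smul 1 hec.aestronglyMeasurable (ae_of_all _ fun t => (hen t).le)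
  set G : ℝ → E := fun t => e t • f' t + (e t * (((-2 * Real.pi * 1 * ω : ℝ) : ℂ) * Complex.I)) • f t
    with hG
  have hGd : ∀ t ∉ s, HasDerivAt (fun t => e t • f t) (G t) t := fun t ht => (hed t).smul (hd t ht)
  have hGs : ∀ t, G t = e t • f' t - (2 * Real.pi * Complex.I * ω) • (e t • f t) := by
    intro t
    simp only [hG, smul_smul, sub_eq_add_neg, ← neg_smul]
    congr 2
    push_cast
    ring
  have hGi : Integrable G := by
    rw [show G = _ from funext hGs]
    exact (hmul hfi').sub ((hmul hfi).smul _)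
  have hlim : ∀ l : Filter ℝ, Tendsto f l (𝓝 0) → Tendsto (fun t => e t • f t) l (𝓝 0) := by
    intro l hl
    rw [tendsto_zero_iff_norm_tendsto_zero] at hl ⊢
    simpa [norm_smul, hen] using hl
  have hint : ∫ t, G t = 0 := by
    have h1 := intervalIntegral_tendsto_integral hGi tendsto_neg_atTop_atBot tendsto_id
    have h2 : ∀ R : ℝ, ∫ t in (-R)..(id R), G t = e R • f R - e (-R) • f (-R) := fun R =>
      MeasureTheory.integral_eq_of_hasDerivAt_off_countable _ _ hs
        (hec.smul hf).continuousOn (fun t ht => hGd t ht.2) hGi.intervalIntegrable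
    simp only [h2] at h1
    have h3 := (hlim _ htop).sub ((hlim _ hbot).comp tendsto_neg_atTop_atBot)
    rw [sub_zero] at h3
    exact tendsto_nhds_unique h1 h3
  rw [Real.fourier_real_eq_integral_exp_smul, Real.fourier_real_eq_integral_exp_smul,
    ← integral_smul, ← sub_eq_zero]
  refine (integral_sub (hmul hfi') ((hmul hfi).smul _)).symm.trans (Eq.trans ?_ hint)
  exact integral_congr_ae (ae_of_all _ fun t => (hGs t).symm)

/-- Gaussian summation replaces Fourier inversion, as `𝓕 h` need not be integrable: averages of `h`
against Gaussians concentrating at `0` equal integrals of `𝓕 h` against positive Gaussians. -/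
theorem re_nonneg_of_re_fourier_nonneg {h : ℝ → ℂ} (hi : Integrable h) (hc : ContinuousAt h 0)
    (hF : ∀ᵐ ω : ℝ, 0 ≤ (𝓕 h ω).re) : 0 ≤ (h 0).re := by
  have hlim := Real.tendsto_integral_gaussian_smul' hi hc
  refine ge_of_tendsto ((Complex.continuous_re.tendsto _).comp hlim) ?_
  filter_upwards [Ioi_mem_atTop 0] with c (hc : 0 < c)
  have J : Integrable (fun w : ℝ => Complex.exp (- (c : ℂ)⁻¹ * ‖w‖ ^ 2)) := by
    simpa using GaussianFourier.integrable_cexp_neg_mul_sq_norm_add (V := ℝ)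
      (b := (c : ℂ)⁻¹) (by simpa [← Complex.ofReal_inv] using hc) 0 0
  have key : ∫ w : ℝ, ((Real.pi * c : ℂ) ^ (Module.finrank ℝ ℝ / 2 : ℂ) *
      Complex.exp (-Real.pi ^ 2 * c * ‖0 - w‖ ^ 2)) • h w =
      ∫ w : ℝ, Complex.exp (- (c : ℂ)⁻¹ * ‖w‖ ^ 2) • 𝓕 h w := by
    have h1 := VectorFourier.integral_fourierIntegral_smul_eq_flip (L := innerₗ ℝ)
      Real.continuous_fourierChar continuous_inner J hi
    have h2 : ∀ w : ℝ, VectorFourier.fourierIntegral Real.fourierChar volume (innerₗ ℝ)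
        (fun w : ℝ => Complex.exp (- (c : ℂ)⁻¹ * ‖w‖ ^ 2)) w =
        (Real.pi * c : ℂ) ^ (Module.finrank ℝ ℝ / 2 : ℂ) *
          Complex.exp (-Real.pi ^ 2 * c * ‖0 - w‖ ^ 2) := by
      intro w
      have := fourier_gaussian_innerProductSpace (V := ℝ) (b := (c : ℂ)⁻¹)
        (by simpa [← Complex.ofReal_inv] using hc) w
      refine Eq.trans this ?_
      rw [div_inv_eq_mul, div_inv_eq_mul, zero_sub, norm_neg]
      congr 2
      ring
    simp only [h2] at h1
    simpa using! h1
  have hre : ((∫ w : ℝ, Complex.exp (- (c : ℂ)⁻¹ * ‖w‖ ^ 2) • 𝓕 h w).re) =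
      ∫ w : ℝ, (Complex.exp (- (c : ℂ)⁻¹ * ‖w‖ ^ 2) • 𝓕 h w).re := by
    refine (integral_re (𝕜 := ℂ) ?_).symm
    refine J.smul_bdd (∫ t, ‖h t‖) ?_ (ae_of_all _ fun w => ?_)
    · exact (VectorFourier.fourierIntegral_continuous Real.continuous_fourierChar
        continuous_inner hi).aestronglyMeasurable
    · exact VectorFourier.norm_fourierIntegral_le_integral_norm _ _ _ _ _
  simp only [Function.comp_apply]
  rw [key, hre]
  refine integral_nonneg_of_ae ?_
  filter_upwards [hF] with w hw
  have : Complex.exp (- (c : ℂ)⁻¹ * ‖w‖ ^ 2) = ((Real.exp (- c⁻¹ * ‖w‖ ^ 2) : ℝ) : ℂ) := by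
    push_cast; rfl
  rw [this, smul_eq_mul, Complex.re_ofReal_mul]
  exact mul_nonneg (Real.exp_pos _).le hw

/-- A one-sided form of Parseval's identity. -/
theorem re_integral_conj_mul_nonneg {u y : ℝ → ℂ} (hu : Integrable u) (hy : Integrable y)
    (hyc : Continuous y) {K : ℝ} (hK : ∀ t, ‖y t‖ ≤ K)
    (hF : ∀ᵐ ω : ℝ, 0 ≤ (conj (𝓕 u ω) * 𝓕 y ω).re) :
    0 ≤ (∫ t, conj (u t) * y t).re := by
  -- The reflected conjugate has transform `conj (𝓕 u)`, and its convolution with `y` takes at `0`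
  -- the value `∫ conj u * y`.
  set v : ℝ → ℂ := fun t => conj (u (-t)) with hv
  have hvi : Integrable v := by
    have := hu.comp_neg
    exact (Complex.conjLIE.toContinuousLinearEquiv.toContinuousLinearMap).integrable_comp this
  have hFv : ∀ ω : ℝ, 𝓕 v ω = conj (𝓕 u ω) := by
    intro ω
    rw [Real.fourier_real_eq_integral_exp_smul, Real.fourier_real_eq_integral_exp_smul,
      ← integral_conj, ← integral_neg_eq_self]
    refine integral_congr_ae (ae_of_all _ fun t => ?_)
    simp [hv, ← Complex.exp_conj, Complex.conj_ofNat]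
  have hh := re_nonneg_of_re_fourier_nonneg (h := v ⋆[ContinuousLinearMap.mul ℂ ℂ, volume] y)
    (hvi.integrable_convolution _ hy)
    (BddAbove.continuous_convolution_right_of_integrable _
      ⟨K, by rintro _ ⟨t, rfl⟩; exact hK t⟩ hvi hyc).continuousAt ?_
  · have : (v ⋆[ContinuousLinearMap.mul ℂ ℂ, volume] y) 0 = ∫ t, conj (u t) * y t := by
      rw [MeasureTheory.convolution_def, ← integral_neg_eq_self]
      simp [hv]
    rwa [this] at hh
  · filter_upwards [hF] with ω hω
    rw [Real.fourier_mul_convolution_eq hvi hy, hFv]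
    exact hω

end Fourier

theorem fourier_continuousLinearMap_comp {E F : Type*} [NormedAddCommGroup E] [NormedSpace ℂ E]
    [CompleteSpace E] [NormedAddCommGroup F] [NormedSpace ℂ F] [CompleteSpace F]
    (L : E →L[ℂ] F) {f : ℝ → E} (hf : Integrable f) (ω : ℝ) :
    𝓕 (fun t => L (f t)) ω = L (𝓕 f ω) := by
  rw [Real.fourier_real_eq, Real.fourier_real_eq, ← L.integral_comp_comm]
  · simp [Circle.smul_def]
  · simpa [mul_comm] using (Real.fourierIntegral_convergent_iff ω).2 hf

theorem fourier_add_of_integrable {E : Type*} [NormedAddCommGroup E] [NormedSpace ℂ E]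
    {f g : ℝ → E} (hf : Integrable f) (hg : Integrable g) (ω : ℝ) :
    𝓕 (fun t => f t + g t) ω = 𝓕 f ω + 𝓕 g ω := by
  simp only [Real.fourier_real_eq, smul_add]
  rw [integral_add]
  · simpa [mul_comm] using (Real.fourierIntegral_convergent_iff ω).2 hf
  · simpa [mul_comm] using (Real.fourierIntegral_convergent_iff ω).2 hg

theorem integrable_of_integrableOn_pieces {E : Type*} [NormedAddCommGroup E] {f : ℝ → E} {a b : ℝ}
    (h0 : ∀ t ≤ a, f t = 0) (h1 : IntegrableOn f (Ioc a b)) (h2 : IntegrableOn f (Ioi b)) :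
    Integrable f := by
  have h3 : IntegrableOn f (Iic a) :=
    (integrableOn_zero : IntegrableOn (fun _ : ℝ => (0 : E)) (Iic a)).congr_fun (fun t ht => (h0 t ht).symm) measurableSet_Iic
  rw [← integrableOn_univ]
  refine ((h3.union h1).union h2).mono_set fun t _ => ?_
  rcases le_or_gt t a with h | h
  · exact Or.inl (Or.inl h)
  · rcases le_or_gt t b with h' | h'
    · exact Or.inl (Or.inr ⟨h, h'⟩)
    · exact Or.inr h'

/-- The exceptional frequencies correspond to roots of the characteristic polynomial, hence are
finitely many. -/
theorem Matrix.ae_det_imaginary_sub_ne_zero {n : ℕ} (A : Matrix (Fin n) (Fin n) ℂ) :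
    ∀ᵐ ω : ℝ, ((Complex.I * ((2 * Real.pi * ω : ℝ) : ℂ)) • (1 : Matrix (Fin n) (Fin n) ℂ) - A).det
      ≠ 0 := by
  have hinj : Function.Injective fun ω : ℝ => Complex.I * ((2 * Real.pi * ω : ℝ) : ℂ) := by
    intro a b hab
    have h := mul_left_cancel₀ Complex.I_ne_zero hab
    exact mul_left_cancel₀ Real.two_pi_pos.ne' (Complex.ofReal_injective h)
  have hfin : Set.Finite {s : ℂ | A.charpoly.IsRoot s} :=
    Polynomial.finite_setOfPred_isRoot A.charpoly_monic.ne_zero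
  have := (hfin.preimage hinj.injOn).measure_zero volume
  filter_upwards [compl_mem_ae_iff.2 this] with ω hω h
  refine hω ?_
  rw [Set.mem_preimage, Set.mem_ofPred_eq, Polynomial.IsRoot, Matrix.eval_charpoly]
  convert h using 3
  rw [Matrix.scalar_apply, Matrix.smul_one_eq_diagonal]

/-- Complexification of a real vector. -/
noncomputable def complexify (n : ℕ) : (Fin n → ℝ) →L[ℝ] (Fin n → ℂ) :=
  ContinuousLinearMap.pi fun k => Complex.ofRealCLM.comp (ContinuousLinearMap.proj k)

@[simp]
theorem complexify_apply {n : ℕ} (x : Fin n → ℝ) (k : Fin n) : complexify n x k = (x k : ℂ) := rfl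

theorem complexify_mulVec {m n : ℕ} (A : Matrix (Fin m) (Fin n) ℝ) (x : Fin n → ℝ) :
    complexify m (A *ᵥ x) = A.map Complex.ofReal *ᵥ complexify n x := by
  ext k
  simp [Matrix.mulVec, dotProduct]

/-! ### From the Nyquist condition to passivity -/

namespace Subsystem

variable {n m : ℕ}

/-- Freezing the integrand at its value at `0` for negative times makes it continuous on the whole
line, which gives a two-sided derivative even at `0`. -/
theorem IsTrajectory.exists_eqOn_hasDerivAt {S : Subsystem n m} {x₀ : Fin n → ℝ} {u : ℝ → Fin m → ℝ}
    {x : ℝ → Fin n → ℝ} (h : S.IsTrajectory x₀ u x) (hu : ContinuousOn u (Ici 0)) :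
    ∃ X : ℝ → Fin n → ℝ, EqOn x X (Ici 0) ∧
      ∀ t, 0 ≤ t → HasDerivAt X (S.A *ᵥ x t + S.B *ᵥ u t) t := by
  set F : ℝ → Fin n → ℝ := fun t => S.A *ᵥ x (max t 0) + S.B *ᵥ u (max t 0) with hF
  have hmax : Continuous fun t : ℝ => max t 0 := continuous_id.max continuous_const
  have hFc : Continuous F :=
    ((Continuous.matrix_mulVec continuous_const
      (h.1.comp_continuous hmax fun t => le_max_right t 0)).add
    (Continuous.matrix_mulVec continuous_const
      (hu.comp_continuous hmax fun t => le_max_right t 0)))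
  refine ⟨fun t => x₀ + ∫ τ in (0 : ℝ)..t, F τ, fun t ht => ?_, fun t ht => ?_⟩
  · rw [h.2 t ht]
    dsimp only
    congr 1
    refine intervalIntegral.integral_congr fun τ hτ => ?_
    rw [uIcc_of_le ht] at hτ
    simp [hF, hτ.1]
  · have := (hFc.integral_hasStrictDerivAt 0 t).hasDerivAt.const_add x₀
    simpa [hF, ht] using this

theorem IsTrajectory.hasDerivAt {S : Subsystem n m} {x₀ : Fin n → ℝ} {u : ℝ → Fin m → ℝ}
    {x : ℝ → Fin n → ℝ} (h : S.IsTrajectory x₀ u x) (hu : ContinuousOn u (Ici 0)) {t : ℝ}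
    (ht : 0 < t) : HasDerivAt x (S.A *ᵥ x t + S.B *ᵥ u t) t := by
  obtain ⟨X, hX, hd⟩ := h.exists_eqOn_hasDerivAt hu
  exact (hd t ht.le).congr_of_eventuallyEq (eventually_of_mem (Ici_mem_nhds ht) hX)

theorem IsTrajectory.hasDerivWithinAt {S : Subsystem n m} {x₀ : Fin n → ℝ} {u : ℝ → Fin m → ℝ}
    {x : ℝ → Fin n → ℝ} (h : S.IsTrajectory x₀ u x) (hu : ContinuousOn u (Ici 0)) {t : ℝ}
    (ht : 0 ≤ t) : HasDerivWithinAt x (S.A *ᵥ x t + S.B *ᵥ u t) (Ici t) t := by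
  obtain ⟨X, hX, hd⟩ := h.exists_eqOn_hasDerivAt hu
  exact (hd t ht).hasDerivWithinAt.congr (fun s hs => hX (ht.trans hs)) (hX ht)

theorem IsTrajectory.apply_zero {S : Subsystem n m} {x₀ : Fin n → ℝ} {u : ℝ → Fin m → ℝ}
    {x : ℝ → Fin n → ℝ} (h : S.IsTrajectory x₀ u x) : x 0 = x₀ := by
  simpa using h.2 0 le_rfl

/-- The vector field `z ↦ (A - μ B C) z` of the subsystem closed by the output feedback
`u = -μ y`, on complex states. -/
noncomputable def closedLoop (S : Subsystem n m) (μ : ℂ) : (Fin n → ℂ) →L[ℝ] (Fin n → ℂ) :=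
  ((Matrix.mulVecLin (S.A.map Complex.ofReal -
    μ • (S.B.map Complex.ofReal * S.C.map Complex.ofReal))).toContinuousLinearMap).restrictScalars ℝ

theorem closedLoop_apply (S : Subsystem n m) (μ : ℂ) (z : Fin n → ℂ) :
    S.closedLoop μ z = S.A.map Complex.ofReal *ᵥ z -
      μ • (S.B.map Complex.ofReal *ᵥ (S.C.map Complex.ofReal *ᵥ z)) := by
  simp [closedLoop, Matrix.mulVec_mulVec]

theorem transfer_mul_eq (S : Subsystem n 1) {s υ : ℂ} {z : Fin n → ℂ}
    (hs : (s • (1 : Matrix (Fin n) (Fin n) ℂ) - S.A.map Complex.ofReal).det ≠ 0)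
    (hz : s • z = S.A.map Complex.ofReal *ᵥ z + S.B.map Complex.ofReal *ᵥ fun _ => υ) :
    (S.C.map Complex.ofReal *ᵥ z) 0 = S.transfer s 0 0 * υ := by
  set R := s • (1 : Matrix (Fin n) (Fin n) ℂ) - S.A.map Complex.ofReal with hR
  have h1 : R *ᵥ z = S.B.map Complex.ofReal *ᵥ fun _ => υ := by
    rw [hR, Matrix.sub_mulVec, Matrix.smul_mulVec, Matrix.one_mulVec, hz, add_sub_cancel_left]
  have h2 : z = R⁻¹ *ᵥ (S.B.map Complex.ofReal *ᵥ fun _ => υ) := by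
    rw [← h1, Matrix.mulVec_mulVec, Matrix.nonsing_inv_mul _ (isUnit_iff_ne_zero.2 hs),
      Matrix.one_mulVec]
  rw [h2, Matrix.mulVec_mulVec, Matrix.mulVec_mulVec, transfer, ← hR]
  simp [Matrix.mulVec, dotProduct]

/-- If the Nyquist plot lies in the closed right half plane and some output feedback `u = -μ y`
with `0 ≤ Re μ` stabilizes the subsystem, then the subsystem is passive. -/
theorem NyquistInClosedRightHalfPlane.isPassive {S : Subsystem n 1}
    (hS : S.NyquistInClosedRightHalfPlane) {μ : ℂ} (hμ : 0 ≤ μ.re)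
    (hstab : ∀ v, Tendsto (fun t : ℝ => NormedSpace.exp (t • S.closedLoop μ) v) atTop (𝓝 0)) :
    S.IsPassive := by
  intro u x hu hx T hT
  obtain ⟨K, c, hc, hK⟩ := exists_norm_exp_smul_le _ hstab
  set AL : (Fin n → ℂ) →L[ℂ] (Fin n → ℂ) :=
    (Matrix.mulVecLin (S.A.map Complex.ofReal)).toContinuousLinearMap with hAL
  set BL : (Fin 1 → ℂ) →L[ℂ] (Fin n → ℂ) :=
    (Matrix.mulVecLin (S.B.map Complex.ofReal)).toContinuousLinearMap with hBL
  set CL : (Fin n → ℂ) →L[ℂ] ℂ := (ContinuousLinearMap.proj 0).comp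
    (Matrix.mulVecLin (S.C.map Complex.ofReal)).toContinuousLinearMap with hCL
  set b : Fin n → ℂ := BL fun _ => 1 with hb
  have hBb : ∀ υ : Fin 1 → ℂ, BL υ = υ 0 • b := by
    intro υ
    rw [hb, ← map_smul]
    congr 1
    ext i
    simp [Subsingleton.elim i 0]
  -- the extended state, input and output
  set z : ℝ → Fin n → ℂ := fun t => if t ≤ T then complexify n (x (max t 0)) else
    NormedSpace.exp ((t - T) • S.closedLoop μ) (complexify n (x T)) with hz
  set y : ℝ → ℂ := fun t => CL (z t) with hy
  set v : ℝ → ℂ := fun t => if t ≤ 0 then 0 else if t ≤ T then (u t 0 : ℂ) else -μ * y t with hv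
  have hz0 : ∀ t ≤ 0, z t = 0 := by
    intro t ht
    simp [hz, ht.trans hT, ht, hx.apply_zero]
  have hz1 : ∀ t, 0 ≤ t → t ≤ T → z t = complexify n (x t) := by
    intro t h0 h1
    simp [hz, h0, h1]
  have hz2 : ∀ t, T < t →
      z t = NormedSpace.exp ((t - T) • S.closedLoop μ) (complexify n (x T)) := by
    intro t ht
    simp [hz, not_le.2 ht]
  have hzc : Continuous z := by
    refine Continuous.if_le ?_ ?_ continuous_id continuous_const ?_
    · exact (complexify n).continuous.comp (hx.1.comp_continuous
        (continuous_id.max continuous_const) fun t => le_max_right t 0)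
    · exact (continuous_exp_smul_apply _ _).comp (continuous_id.sub continuous_const)
    · intro t ht
      have ht : t = T := ht
      subst ht
      rw [sub_self, exp_zero_smul_apply, max_eq_left hT]
  have hyc : Continuous y := CL.continuous.comp hzc
  have htail : ∀ t, T < t → ‖z t‖ ≤ K * Real.exp (-c * (t - T)) * ‖complexify n (x T)‖ := by
    intro t ht
    rw [hz2 t ht]
    exact (ContinuousLinearMap.le_opNorm _ _).trans
      (mul_le_mul_of_nonneg_right (hK _ (sub_pos.2 ht).le) (norm_nonneg _))
  have hbot : Tendsto z atBot (𝓝 0) :=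
    tendsto_const_nhds.congr' ((eventually_le_atBot 0).mono fun t ht => (hz0 t ht).symm)
  have htop : Tendsto z atTop (𝓝 0) := by
    refine ((hstab (complexify n (x T))).comp (tendsto_atTop_add_const_right _ (-T) tendsto_id)).congr'
      ((eventually_gt_atTop T).mono fun t ht => ?_)
    simp [hz2 t ht, sub_eq_add_neg]
  have hzi : Integrable z := by
    refine integrable_of_integrableOn_pieces hz0
      ((hzc.continuousOn.integrableOn_Icc).mono_set Ioc_subset_Icc_self) (b := T) ?_
    have hexp : IntegrableOn (fun t => K * Real.exp (-c * (t - T)) * ‖complexify n (x T)‖)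
        (Ioi T) := by
      have h1 : IntegrableOn (fun t => Real.exp (-c * t)) (Ioi T) := exp_neg_integrableOn_Ioi T hc
      refine (h1.const_mul (K * Real.exp (c * T) * ‖complexify n (x T)‖)).congr
        (ae_of_all _ fun t => ?_)
      have : -c * (t - T) = c * T + -c * t := by ring
      simp only [this, Real.exp_add]
      ring
    exact hexp.mono' hzc.aestronglyMeasurable.restrict
      ((ae_restrict_iff' measurableSet_Ioi).2 (ae_of_all _ htail))
  have hyi : Integrable y := CL.integrable_comp hzi
  have hvi : Integrable v := by
    refine integrable_of_integrableOn_pieces (a := 0) (b := T) (fun t ht => by simp [hv, ht]) ?_ ?_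
    · have h1 : ContinuousOn (fun t => ((u t 0 : ℝ) : ℂ)) (Icc 0 T) :=
        Complex.continuous_ofReal.comp_continuousOn
          (((continuous_apply 0).comp_continuousOn hu).mono Icc_subset_Ici_self)
      refine (h1.integrableOn_Icc.mono_set Ioc_subset_Icc_self).congr_fun (fun t ht => ?_)
        measurableSet_Ioc
      simp [hv, not_le.2 ht.1, ht.2]
    · refine (hyi.const_mul (-μ)).integrableOn.congr_fun (fun t ht => ?_) measurableSet_Ioi
      have ht : T < t := ht
      simp [hv, not_le.2 ht, not_le.2 (hT.trans_lt ht)]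
  obtain ⟨Ky, hKy⟩ : ∃ Ky, ∀ t, ‖y t‖ ≤ Ky := by
    obtain ⟨K₁, hK₁⟩ := (isCompact_Icc (a := 0) (b := T)).exists_bound_of_continuousOn
      hyc.continuousOn
    refine ⟨max K₁ (‖CL‖ * (|K| * ‖complexify n (x T)‖)), fun t => ?_⟩
    rcases le_or_gt t 0 with h | h
    · refine le_max_of_le_left ?_
      have := (norm_nonneg _).trans (hK₁ 0 ⟨le_rfl, hT⟩)
      simpa [hy, hz0 t h] using this
    rcases le_or_gt t T with h' | h'
    · exact le_max_of_le_left (hK₁ t ⟨h.le, h'⟩)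
    · refine le_max_of_le_right ((CL.le_opNorm _).trans ?_)
      refine mul_le_mul_of_nonneg_left ((htail t h').trans ?_) (norm_nonneg _)
      refine mul_le_mul_of_nonneg_right ?_ (norm_nonneg _)
      have h1 : Real.exp (-c * (t - T)) ≤ 1 := Real.exp_le_one_iff.2 (by nlinarith)
      calc K * Real.exp (-c * (t - T)) ≤ |K| * Real.exp (-c * (t - T)) :=
            mul_le_mul_of_nonneg_right (le_abs_self K) (Real.exp_pos _).le
        _ ≤ |K| * 1 := mul_le_mul_of_nonneg_left h1 (abs_nonneg K)
        _ = |K| := mul_one _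
  -- the differential equation, and its Fourier transform
  have hzd : ∀ t ∉ ({0, T} : Set ℝ), HasDerivAt z (AL (z t) + v t • b) t := by
    intro t ht
    simp only [mem_insert_iff, mem_singleton_iff, not_or] at ht
    rcases lt_or_gt_of_ne ht.1 with h | h
    · have : HasDerivAt (fun _ : ℝ => (0 : Fin n → ℂ)) 0 t := hasDerivAt_const t _
      refine (this.congr_of_eventuallyEq
        (eventually_of_mem (Iic_mem_nhds h) fun s hs => hz0 s hs)).congr_deriv ?_
      simp [hz0 t h.le, hv, h.le]
    rcases lt_or_gt_of_ne ht.2 with h' | h'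
    · have := (complexify n).hasFDerivAt.comp_hasDerivAt t (hx.hasDerivAt hu h)
      refine (this.congr_of_eventuallyEq
        (eventually_of_mem (Icc_mem_nhds h h') fun s hs => hz1 s hs.1 hs.2)).congr_deriv ?_
      rw [map_add, complexify_mulVec, complexify_mulVec, hz1 t h.le h'.le]
      have : S.B.map Complex.ofReal *ᵥ complexify 1 (u t) = BL (complexify 1 (u t)) := rfl
      rw [this, hBb]
      simp [hAL, hv, not_le.2 h, h'.le]
    · have := (hasDerivAt_exp_smul_apply (S.closedLoop μ) (complexify n (x T)) (t - T)).comp_sub_const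
        t T
      refine (this.congr_of_eventuallyEq
        (eventually_of_mem (Ioi_mem_nhds h') fun s hs => hz2 s hs)).congr_deriv ?_
      rw [← hz2 t h', closedLoop_apply]
      have : S.B.map Complex.ofReal *ᵥ (S.C.map Complex.ofReal *ᵥ z t) = CL (z t) • b :=
        hBb _
      rw [this]
      simp [hAL, hv, hy, not_le.2 h, not_le.2 h', smul_smul, sub_eq_add_neg]
  have hALi : Integrable fun t => AL (z t) := AL.integrable_comp hzi
  have hF : ∀ ω : ℝ, (Complex.I * ((2 * Real.pi * ω : ℝ) : ℂ)) • 𝓕 z ω =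
      S.A.map Complex.ofReal *ᵥ 𝓕 z ω + S.B.map Complex.ofReal *ᵥ fun _ => 𝓕 v ω := by
    intro ω
    have h1 := fourier_deriv_off_countable (Set.toFinite {0, T}).countable hzc hzd hzi
      (hALi.add (hvi.smul_const b)) hbot htop ω
    have h2 : 𝓕 (fun t => AL (z t) + v t • b) ω = AL (𝓕 z ω) + 𝓕 v ω • b := by
      rw [← fourier_continuousLinearMap_comp AL hzi]
      have h3 := fourier_continuousLinearMap_comp
        ((ContinuousLinearMap.id ℂ ℂ).smulRight b) hvi ω
      simp only [ContinuousLinearMap.smulRight_apply, ContinuousLinearMap.id_apply] at h3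
      rw [← h3]
      exact fourier_add_of_integrable hALi (hvi.smul_const b) ω
    rw [h2] at h1
    have h4 : S.B.map Complex.ofReal *ᵥ (fun _ => 𝓕 v ω) = 𝓕 v ω • b := hBb fun _ => 𝓕 v ω
    rw [h4]
    refine Eq.trans ?_ h1.symm
    congr 1
    push_cast
    ring
  -- In frequency, `conj (𝓕 v) * 𝓕 y` is the transfer function times `|𝓕 v|²`.
  have hpos : 0 ≤ (∫ t, conj (v t) * y t).re := by
    refine re_integral_conj_mul_nonneg hvi hyi hyc hKy ?_
    filter_upwards [Matrix.ae_det_imaginary_sub_ne_zero (S.A.map Complex.ofReal)] with ω hω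
    have h1 : 𝓕 y ω = S.transfer (Complex.I * ((2 * Real.pi * ω : ℝ) : ℂ)) 0 0 * 𝓕 v ω := by
      rw [← S.transfer_mul_eq hω (hF ω)]
      exact fourier_continuousLinearMap_comp CL hzi ω
    rw [h1, mul_left_comm, ← Complex.normSq_eq_conj_mul_self, Complex.re_mul_ofReal]
    exact mul_nonneg (hS _ hω) (Complex.normSq_nonneg _)
  -- the input `-μ y` applied after time `T` supplies a nonpositive energy
  have hvy : Integrable fun t => conj (v t) * y t := by
    refine Integrable.mul_bdd (c := Ky) ?_ hyc.aestronglyMeasurable (ae_of_all _ hKy)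
    exact (Complex.conjLIE.toContinuousLinearEquiv.toContinuousLinearMap).integrable_comp hvi
  have hre : (∫ t, conj (v t) * y t).re = ∫ t, (conj (v t) * y t).re :=
    (integral_re (𝕜 := ℂ) hvy).symm
  have hreal : ∀ t ∈ Ioc 0 T, (conj (v t) * y t).re = u t ⬝ᵥ (S.C *ᵥ x t) := by
    intro t ht
    have h1 : y t = (((S.C *ᵥ x t) 0 : ℝ) : ℂ) := by
      have := congrFun (complexify_mulVec S.C (x t)) 0
      rw [complexify_apply] at this
      rw [this, hy]
      simp only [hz1 t ht.1.le ht.2]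
      rfl
    rw [h1]
    simp [hv, not_le.2 ht.1, ht.2, dotProduct]
  rw [intervalIntegral.integral_of_le hT, ← setIntegral_congr_fun measurableSet_Ioc hreal,
    ← integral_indicator measurableSet_Ioc]
  rw [hre] at hpos
  refine hpos.trans (integral_mono hvy.re (hvy.re.indicator measurableSet_Ioc) fun t => ?_)
  by_cases ht : t ∈ Ioc 0 T
  · simp [ht]
  · rw [Set.indicator_of_notMem ht]
    rcases le_or_gt t 0 with h | h
    · simp [hv, h]
    · have h' : T < t := not_le.1 fun h' => ht ⟨h, h'⟩
      have : conj (v t) * y t = -(conj μ * (Complex.normSq (y t) : ℂ)) := by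
        rw [Complex.normSq_eq_conj_mul_self]
        simp only [hv, not_le.2 h, not_le.2 h', if_false, map_mul, map_neg]
        ring
      have h3 : (conj (v t) * y t).re ≤ 0 := by
        rw [this, Complex.neg_re, Complex.re_mul_ofReal, Complex.conj_re]
        exact neg_nonpos.2 (mul_nonneg hμ (Complex.normSq_nonneg _))
      exact h3

end Subsystem

/-! ### From synchronization to a stabilizing feedback -/

namespace Network

variable {N n m : ℕ}

/-- The vector field of the undisturbed network. -/
noncomputable def vectorField (S : Subsystem n m) (g : Matrix (Fin N) (Fin N) ℝ) (α : ℝ) :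
    (Fin N → Fin n → ℝ) →L[ℝ] (Fin N → Fin n → ℝ) :=
  LinearMap.toContinuousLinearMap <| LinearMap.pi fun i =>
    S.A.mulVecLin ∘ₗ (LinearMap.proj i : (Fin N → Fin n → ℝ) →ₗ[ℝ] (Fin n → ℝ)) +
      α • ∑ j ∈ Finset.univ.erase i, g i j • ((S.B * S.C).mulVecLin ∘ₗ
        ((LinearMap.proj j : (Fin N → Fin n → ℝ) →ₗ[ℝ] (Fin n → ℝ)) - LinearMap.proj i))

theorem vectorField_apply (S : Subsystem n m) (g : Matrix (Fin N) (Fin N) ℝ) (α : ℝ)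
    (x : Fin N → Fin n → ℝ) (i : Fin N) :
    vectorField S g α x i = S.A *ᵥ x i + S.B *ᵥ couplingInput g α (fun j => S.C *ᵥ x j) i := by
  simp [vectorField, couplingInput, Matrix.mulVec_smul, Matrix.mulVec_sum, Matrix.mulVec_sub,
    Matrix.mulVec_mulVec]

theorem isTrajectory_exp (S : Subsystem n m) (g : Matrix (Fin N) (Fin N) ℝ) (α : ℝ)
    (x₀ : Fin N → Fin n → ℝ) :
    IsTrajectory S g α x₀ 0 fun t => NormedSpace.exp (t • vectorField S g α) x₀ := by
  intro i
  have hc := continuous_exp_smul_apply (vectorField S g α) x₀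
  have hci : Continuous fun t : ℝ => NormedSpace.exp (t • vectorField S g α) x₀ i :=
    (continuous_apply i).comp hc
  refine ⟨hci.continuousOn, fun t _ => ?_⟩
  have hd : ∀ t : ℝ, HasDerivAt (fun t : ℝ => NormedSpace.exp (t • vectorField S g α) x₀ i)
      (vectorField S g α (NormedSpace.exp (t • vectorField S g α) x₀) i) t := fun t =>
    hasDerivAt_pi.1 (hasDerivAt_exp_smul_apply (vectorField S g α) x₀ t) i
  have hint := intervalIntegral.integral_eq_sub_of_hasDerivAt (a := 0) (b := t)
    (fun t _ => hd t)
    (((continuous_apply i).comp ((vectorField S g α).continuous.comp hc)).intervalIntegrable _ _)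
  rw [exp_zero_smul_apply] at hint
  simp only [Pi.zero_apply, add_zero, ← vectorField_apply S g α, hint]
  simp

theorem zero_mem_syncManifold : (0 : Fin N → Fin n → ℝ) ∈ syncManifold N n := fun _ _ => rfl

theorem norm_sub_le_two_mul_infDist (x : Fin N → Fin n → ℝ) (i j : Fin N) :
    ‖x i - x j‖ ≤ 2 * Metric.infDist x (syncManifold N n) := by
  have : ‖x i - x j‖ / 2 ≤ Metric.infDist x (syncManifold N n) := by
    refine (Metric.le_infDist ⟨0, zero_mem_syncManifold⟩).2 fun p hp => ?_
    have h1 := dist_le_pi_dist x p i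
    have h2 := dist_le_pi_dist x p j
    have h3 : dist (x i) (x j) ≤ dist (x i) (p i) + dist (x j) (p j) := by
      rw [hp i j]
      exact dist_triangle_right _ _ _
    rw [← dist_eq_norm]
    linarith
  linarith

/-- Local attractivity is global by linearity: scaling by `r` brings any initial state within `δ` of
the manifold. -/
theorem SyncAsymptoticallyStable.tendsto_sub {S : Subsystem n m} {g : Matrix (Fin N) (Fin N) ℝ}
    {α : ℝ} (h : SyncAsymptoticallyStable S g α) (x₀ : Fin N → Fin n → ℝ) (i j : Fin N) :
    Tendsto (fun t : ℝ => NormedSpace.exp (t • vectorField S g α) x₀ i -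
      NormedSpace.exp (t • vectorField S g α) x₀ j) atTop (𝓝 0) := by
  obtain ⟨δ, hδ, H⟩ := h.2
  set r : ℝ := δ / (2 * (‖x₀‖ + 1)) with hr
  have hr0 : 0 < r := by positivity
  have hdist : Metric.infDist (r • x₀) (syncManifold N n) < δ := by
    refine (Metric.infDist_le_dist_of_mem zero_mem_syncManifold).trans_lt ?_
    rw [dist_zero_right, norm_smul, Real.norm_of_nonneg hr0.le, hr, div_mul_eq_mul_div,
      div_lt_iff₀ (by positivity)]
    nlinarith [norm_nonneg x₀]
  have ht := H _ _ (isTrajectory_exp S g α (r • x₀)) hdist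
  have hsub : Tendsto (fun t : ℝ => NormedSpace.exp (t • vectorField S g α) (r • x₀) i -
      NormedSpace.exp (t • vectorField S g α) (r • x₀) j) atTop (𝓝 0) := by
    refine squeeze_zero_norm (fun t => norm_sub_le_two_mul_infDist _ i j) ?_
    simpa using ht.const_mul 2
  have := hsub.const_smul r⁻¹
  simp only [map_smul, Pi.smul_apply, ← smul_sub, inv_smul_smul₀ hr0.ne', smul_zero] at this
  exact this

/-- The Laplacian matrix of the weights. -/
def laplacian (g : Matrix (Fin N) (Fin N) ℝ) : Matrix (Fin N) (Fin N) ℝ :=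
  Matrix.of fun i j => if i = j then ∑ k ∈ Finset.univ.erase i, g i k else -g i j

theorem laplacian_apply_self (g : Matrix (Fin N) (Fin N) ℝ) (i : Fin N) :
    laplacian g i i = ∑ k ∈ Finset.univ.erase i, g i k := by
  simp [laplacian]

theorem laplacian_apply_ne (g : Matrix (Fin N) (Fin N) ℝ) {i j : Fin N} (h : j ≠ i) :
    laplacian g i j = -g i j := by
  simp [laplacian, h.symm]

theorem sum_laplacian_smul {E : Type*} [AddCommGroup E] [Module ℝ E]
    (g : Matrix (Fin N) (Fin N) ℝ) (y : Fin N → E) (i : Fin N) :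
    ∑ j, laplacian g i j • y j = -∑ j ∈ Finset.univ.erase i, g i j • (y j - y i) := by
  rw [← Finset.add_sum_erase _ _ (Finset.mem_univ i), laplacian_apply_self, Finset.sum_smul,
    ← Finset.sum_add_distrib, ← Finset.sum_neg_distrib]
  refine Finset.sum_congr rfl fun j hj => ?_
  rw [laplacian_apply_ne g (Finset.ne_of_mem_erase hj), smul_sub, neg_smul]
  abel

theorem sum_laplacian (g : Matrix (Fin N) (Fin N) ℝ) (i : Fin N) : ∑ j, laplacian g i j = 0 := by
  simpa using sum_laplacian_smul g (fun _ => (1 : ℝ)) i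

/-- The Laplacian acts on the row vectors with zero sum, and its eigenvalues have nonnegative
real part. -/
theorem exists_laplacian_left_eigenvector {g : Matrix (Fin N) (Fin N) ℝ}
    (hg : ∀ i j, i ≠ j → 0 ≤ g i j) {a b : Fin N} (hab : a ≠ b) :
    ∃ (q : Fin N → ℂ) (l : ℂ), q ≠ 0 ∧ ∑ i, q i = 0 ∧ 0 ≤ l.re ∧
      ∀ j, ∑ i, q i * (laplacian g i j : ℂ) = l * q j := by
  set L : Matrix (Fin N) (Fin N) ℂ := (laplacian g).map Complex.ofReal with hL
  set K : Submodule ℂ (Fin N → ℂ) := LinearMap.ker (∑ i, LinearMap.proj i : (Fin N → ℂ) →ₗ[ℂ] ℂ)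
    with hK
  have hmem : ∀ q : Fin N → ℂ, q ∈ K ↔ ∑ i, q i = 0 := by
    intro q
    simp [hK, LinearMap.mem_ker]
  -- The rows of the Laplacian sum to zero, so its left action even maps every vector into `K`.
  have hinv : ∀ q ∈ K, Matrix.vecMulLinear L q ∈ K := by
    intro q _
    rw [hmem]
    simp only [Matrix.vecMulLinear_apply, Matrix.vecMul, dotProduct]
    rw [Finset.sum_comm]
    refine Finset.sum_eq_zero fun i _ => ?_
    rw [← Finset.mul_sum]
    have : ∑ j, L i j = ((∑ j, laplacian g i j : ℝ) : ℂ) := by simp [hL]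
    rw [this, sum_laplacian]
    simp
  have : Nontrivial K := by
    refine ⟨⟨⟨Pi.single a 1 - Pi.single b 1, (hmem _).2 (by simp)⟩, 0, fun h => ?_⟩⟩
    have := congrFun (congrArg Subtype.val h) a
    simp [hab] at this
  obtain ⟨l, hl⟩ := Module.End.exists_eigenvalue ((Matrix.vecMulLinear L).restrict hinv)
  obtain ⟨q, hq⟩ := hl.exists_hasEigenvector
  have hq0 : (q : Fin N → ℂ) ≠ 0 := fun h => hq.2 (Subtype.ext h)
  have hqL : (q : Fin N → ℂ) ᵥ* L = l • (q : Fin N → ℂ) :=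
    congrArg Subtype.val hq.apply_eq_smul
  refine ⟨q, l, hq0, (hmem _).1 q.2, ?_, fun j => ?_⟩
  -- A left eigenvalue is also a right one. Its Gershgorin disc has centre and radius both equal to
  -- a diagonal entry, so it lies in the closed right half plane.
  · have hdet : (L - l • (1 : Matrix (Fin N) (Fin N) ℂ)).det = 0 :=
      Matrix.exists_vecMul_eq_zero_iff.1
        ⟨q, hq0, by rw [Matrix.vecMul_sub, hqL, Matrix.vecMul_smul, Matrix.vecMul_one, sub_self]⟩
    obtain ⟨p, hp0, hp⟩ := Matrix.exists_mulVec_eq_zero_iff.2 hdet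
    have hev : Module.End.HasEigenvalue (Matrix.toLin' L) l := by
      refine Module.End.hasEigenvalue_of_hasEigenvector (x := p)
        (Module.End.hasEigenvector_iff.2 ⟨Module.End.mem_eigenspace_iff.2 ?_, hp0⟩)
      rw [Matrix.sub_mulVec, Matrix.smul_mulVec, Matrix.one_mulVec, sub_eq_zero] at hp
      rw [Matrix.toLin'_apply, hp]
    obtain ⟨k, hk⟩ := eigenvalue_mem_ball hev
    have hsum : ∑ j ∈ Finset.univ.erase k, ‖L k j‖ = laplacian g k k := by
      rw [laplacian_apply_self]
      refine Finset.sum_congr rfl fun j hj => ?_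
      have hj := Finset.ne_of_mem_erase hj
      simp [hL, laplacian_apply_ne g hj, abs_of_nonneg (hg k j hj.symm)]
    rw [hsum, Metric.mem_closedBall, dist_eq_norm] at hk
    have h1 := (abs_le.1 ((Complex.abs_re_le_norm _).trans hk)).1
    simp only [hL, Matrix.map_apply, Complex.sub_re, Complex.ofReal_re] at h1
    linarith
  · have := congrFun hqL j
    simpa [Matrix.vecMul, dotProduct, hL] using this

/-- The weighted sum of the subsystem states, as a complex vector. -/
noncomputable def weightedSum (q : Fin N → ℂ) : (Fin N → Fin n → ℝ) →L[ℝ] (Fin n → ℂ) :=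
  ∑ i, q i • (complexify n).comp (ContinuousLinearMap.proj i)

theorem weightedSum_apply (q : Fin N → ℂ) (x : Fin N → Fin n → ℝ) :
    weightedSum q x = ∑ i, q i • complexify n (x i) := by
  simp [weightedSum]

/-- All subsystems share `A`, `B`, `C`, so a left eigenvector of the Laplacian decouples one mode
from the network. -/
theorem weightedSum_vectorField (S : Subsystem n m) (g : Matrix (Fin N) (Fin N) ℝ) (α : ℝ)
    {q : Fin N → ℂ} {l : ℂ} (hq : ∀ j, ∑ i, q i * (laplacian g i j : ℂ) = l * q j)
    (x : Fin N → Fin n → ℝ) :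
    weightedSum q (vectorField S g α x) = S.closedLoop (α * l) (weightedSum q x) := by
  set D : (Fin n → ℂ) →ₗ[ℂ] (Fin n → ℂ) :=
    Matrix.mulVecLin (S.B.map Complex.ofReal * S.C.map Complex.ofReal) with hD
  have h1 : ∀ i, complexify n (vectorField S g α x i) = S.A.map Complex.ofReal *ᵥ complexify n (x i)
      - (α : ℂ) • ∑ j, (laplacian g i j : ℂ) • D (complexify n (x j)) := by
    intro i
    have h2 := sum_laplacian_smul g (fun j => S.C *ᵥ x j) i
    have h3 : couplingInput g α (fun j => S.C *ᵥ x j) i =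
        -(α • ∑ j, laplacian g i j • (S.C *ᵥ x j)) := by
      rw [h2, couplingInput, smul_neg, neg_neg]
    rw [vectorField_apply, h3, map_add, complexify_mulVec, sub_eq_add_neg]
    congr 1
    rw [Matrix.mulVec_neg, map_neg, Matrix.mulVec_smul, map_smul, Matrix.mulVec_sum, map_sum]
    congr 1
    rw [← Complex.coe_smul]
    congr 1
    refine Finset.sum_congr rfl fun j _ => ?_
    rw [Matrix.mulVec_smul, map_smul, complexify_mulVec, complexify_mulVec, ← Complex.coe_smul,
      Matrix.mulVec_mulVec]
    rfl
  have h4 : ∑ i, q i • (α : ℂ) • ∑ j, (laplacian g i j : ℂ) • D (complexify n (x j)) =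
      ((α : ℂ) * l) • D (∑ j, q j • complexify n (x j)) := by
    simp only [map_sum, map_smul, Finset.smul_sum, smul_smul]
    rw [Finset.sum_comm]
    refine Finset.sum_congr rfl fun j _ => ?_
    rw [← Finset.sum_smul, mul_assoc, ← hq j, Finset.mul_sum]
    congr 1
    exact Finset.sum_congr rfl fun i _ => by ring
  rw [weightedSum_apply, weightedSum_apply, Subsystem.closedLoop_apply, Matrix.mulVec_mulVec]
  simp only [h1, smul_sub, Finset.sum_sub_distrib]
  rw [h4]
  congr 1
  simp [Matrix.mulVec_sum, Matrix.mulVec_smul]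

/-- Asymptotic stability of the synchronization manifold makes some output feedback with gain in
the closed right half plane stabilizing. -/
theorem SyncAsymptoticallyStable.exists_stabilizing_feedback {S : Subsystem n m}
    {g : Matrix (Fin N) (Fin N) ℝ} {α : ℝ} (h : SyncAsymptoticallyStable S g α)
    (hg : ∀ i j, i ≠ j → 0 ≤ g i j) (hα : 0 ≤ α) {a b : Fin N} (hab : a ≠ b) :
    ∃ μ : ℂ, 0 ≤ μ.re ∧
      ∀ v, Tendsto (fun t : ℝ => NormedSpace.exp (t • S.closedLoop μ) v) atTop (𝓝 0) := by
  obtain ⟨q, l, hq0, hqs, hl, hq⟩ := exists_laplacian_left_eigenvector hg hab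
  refine ⟨α * l, by rw [Complex.re_ofReal_mul]; exact mul_nonneg hα hl, fun v => ?_⟩
  set F := vectorField S g α with hF
  have hd : ∀ (x₀ : Fin N → Fin n → ℝ) (t : ℝ),
      HasDerivAt (fun t : ℝ => weightedSum q (NormedSpace.exp (t • F) x₀))
        (S.closedLoop (α * l) (weightedSum q (NormedSpace.exp (t • F) x₀))) t := by
    intro x₀ t
    rw [← weightedSum_vectorField S g α hq]
    exact (weightedSum q).hasFDerivAt.comp_hasDerivAt t (hasDerivAt_exp_smul_apply F x₀ t)
  have hlim : ∀ x₀ : Fin N → Fin n → ℝ,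
      Tendsto (fun t : ℝ => weightedSum q (NormedSpace.exp (t • F) x₀)) atTop (𝓝 0) := by
    intro x₀
    have h1 : ∀ x : Fin N → Fin n → ℝ,
        weightedSum q x = ∑ i, q i • complexify n (x i - x a) := by
      intro x
      simp only [map_sub, smul_sub, Finset.sum_sub_distrib, ← Finset.sum_smul, hqs, zero_smul,
        sub_zero, weightedSum_apply]
    simp only [h1]
    rw [show (0 : Fin n → ℂ) = ∑ i, q i • complexify n 0 by simp]
    exact tendsto_finsetSum _ fun i _ =>
      (((complexify n).continuous.tendsto 0).comp (h.tendsto_sub x₀ i a)).const_smul (q i)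
  -- Network states are real and `v` is complex: two initial states supported at one vertex `k` with
  -- `q k ≠ 0` produce its real and imaginary parts after division by `q k`.
  obtain ⟨k, hk⟩ := Function.ne_iff.1 hq0
  set w : Fin n → ℂ := (q k)⁻¹ • v with hw
  set x₁ : Fin N → Fin n → ℝ := Pi.single k fun r => (w r).re with hx₁
  set x₂ : Fin N → Fin n → ℝ := Pi.single k fun r => (w r).im with hx₂
  have hsingle : ∀ p : Fin n → ℝ, weightedSum q (Pi.single k p) = q k • complexify n p := by
    intro p
    rw [weightedSum_apply, Finset.sum_eq_single k]
    · simp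
    · intro i _ hi
      simp [hi]
    · simp
  have h0 : weightedSum q x₁ + Complex.I • weightedSum q x₂ = v := by
    rw [hx₁, hx₂, hsingle, hsingle, smul_comm, ← smul_add]
    have : (complexify n fun r => (w r).re) + Complex.I • (complexify n fun r => (w r).im) = w := by
      ext r
      simp [mul_comm Complex.I, Complex.re_add_im]
    rw [this, hw, smul_inv_smul₀ hk]
  have hz := eq_exp_smul_of_linear_ode (S.closedLoop (α * l))
    (z := fun t => weightedSum q (NormedSpace.exp (t • F) x₁) +
      Complex.I • weightedSum q (NormedSpace.exp (t • F) x₂)) fun t => by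
        refine ((hd x₁ t).add ((hd x₂ t).const_smul Complex.I)).congr_deriv ?_
        rw [map_add]
        congr 1
        simp [Subsystem.closedLoop_apply, Matrix.mulVec_smul, smul_sub, smul_comm Complex.I]
  have hlim' := (hlim x₁).add ((hlim x₂).const_smul Complex.I)
  rw [smul_zero, add_zero] at hlim'
  refine hlim'.congr' ((eventually_ge_atTop 0).mono fun t ht => ?_)
  have := hz t ht
  simp only [exp_zero_smul_apply, h0] at this
  exact this

end Network

/-! ### Energy balance and the maximum principle -/

namespace Network

variable {N n m : ℕ}

theorem couplingInput_continuousOn {S : Subsystem n m} (g : Matrix (Fin N) (Fin N) ℝ) (α : ℝ)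
    {x : ℝ → Fin N → Fin n → ℝ} {s : Set ℝ} (hx : ∀ i, ContinuousOn (fun t => x t i) s)
    (i : Fin N) : ContinuousOn (fun t => couplingInput g α (fun j => S.C *ᵥ x t j) i) s := by
  have hy : ∀ j, ContinuousOn (fun t => S.C *ᵥ x t j) s := fun j =>
    (Continuous.matrix_mulVec continuous_const continuous_id).comp_continuousOn (hx j)
  exact (continuousOn_finsetSum _ fun j _ => ((hy j).sub (hy i)).const_smul (g i j)).const_smul α

/-- Subsystems that receive neither the disturbance nor inputs from the others stay at rest. -/
theorem IsTrajectory.eq_zero_of_isolated {S : Subsystem n m} {g : Matrix (Fin N) (Fin N) ℝ} {α : ℝ}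
    {d : ℝ → Fin N → Fin m → ℝ} {x : ℝ → Fin N → Fin n → ℝ} (hx : IsTrajectory S g α 0 d x)
    {W : Finset (Fin N)} (hd : ∀ i ∈ W, ∀ t, d t i = 0)
    (hW : ∀ i ∈ W, ∀ j ∉ W, α * g i j = 0) {i : Fin N} (hi : i ∈ W) {t : ℝ} (ht : 0 ≤ t) :
    x t i = 0 := by
  have hc : ∀ i, ContinuousOn (fun t => x t i) (Ici 0) := fun i => (hx i).1
  -- Erasing the states outside `W` leaves a solution of an autonomous linear equation started at
  -- zero, so uniqueness applies.
  set P : (Fin N → Fin n → ℝ) →L[ℝ] (Fin N → Fin n → ℝ) :=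
    ContinuousLinearMap.pi fun i => if i ∈ W then ContinuousLinearMap.proj i else 0 with hP
  have hP1 : ∀ y, ∀ i ∈ W, P y i = y i := fun y i hi => by simp [hP, hi]
  have hP0 : ∀ y, ∀ i ∉ W, P y i = 0 := fun y i hi => by simp [hP, hi]
  have hPF : ∀ t, ∀ i ∈ W, vectorField S g α (P (x t)) i =
      S.A *ᵥ x t i + S.B *ᵥ (couplingInput g α (fun j => S.C *ᵥ x t j) i + d t i) := by
    intro t i hi
    rw [vectorField_apply, hP1 _ i hi, hd i hi, add_zero]
    congr 2
    simp only [couplingInput, Finset.smul_sum, smul_smul]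
    refine Finset.sum_congr rfl fun j _ => ?_
    by_cases hj : j ∈ W
    · rw [hP1 _ i hi, hP1 _ j hj]
    · rw [hW i hi j hj, zero_smul, zero_smul]
  have key := eqOn_zero_of_linear_ode (P.comp (vectorField S g α)) (z := fun t => P (x t))
    (P.continuous.comp_continuousOn (continuousOn_pi.2 hc)) (fun t ht => ?_) ?_ t ht
  · rw [← hP1 (x t) i hi, key, Pi.zero_apply]
  · refine hasDerivWithinAt_pi.2 fun i => ?_
    by_cases hi : i ∈ W
    · simp only [ContinuousLinearMap.comp_apply, hP1 _ i hi, hPF t i hi]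
      refine (hx i).hasDerivWithinAt ?_ ht
      simpa [hd i hi] using couplingInput_continuousOn g α hc i
    · simp only [ContinuousLinearMap.comp_apply, hP0 _ i hi]
      exact hasDerivWithinAt_const _ _ _
  · have : x 0 = 0 := funext fun i => (hx i).apply_zero
    simp [this]

theorem IsTrajectory.output_continuousOn {S : Subsystem n m} {g : Matrix (Fin N) (Fin N) ℝ}
    {α : ℝ} {x₀ : Fin N → Fin n → ℝ} {d : ℝ → Fin N → Fin m → ℝ} {x : ℝ → Fin N → Fin n → ℝ}
    (hx : IsTrajectory S g α x₀ d x) (i : Fin N) :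
    ContinuousOn (fun t => S.C *ᵥ x t i) (Ici 0) :=
  (Continuous.matrix_mulVec continuous_const continuous_id).comp_continuousOn (hx i).1

theorem energy_nonneg (S : Subsystem n m) (x : ℝ → Fin N → Fin n → ℝ) {T : ℝ} (hT : 0 ≤ T)
    (i : Fin N) : 0 ≤ energy S x T i :=
  intervalIntegral.integral_nonneg hT fun _ _ =>
    Finset.sum_nonneg fun _ _ => mul_self_nonneg _

/-- The energy balance of a passive subsystem that does not receive the disturbance. -/
theorem IsTrajectory.sum_energy_sub_nonneg {S : Subsystem n m} (hS : S.IsPassive)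
    {g : Matrix (Fin N) (Fin N) ℝ} (hg : ∀ i j, i ≠ j → 0 ≤ g i j) {α : ℝ} (hα : 0 ≤ α)
    {d : ℝ → Fin N → Fin m → ℝ} {x : ℝ → Fin N → Fin n → ℝ} (hx : IsTrajectory S g α 0 d x)
    {i : Fin N} (hd : ∀ t, d t i = 0) {T : ℝ} (hT : 0 ≤ T) :
    0 ≤ ∑ j ∈ Finset.univ.erase i, α * g i j * (energy S x T j - energy S x T i) := by
  have hc : ∀ i, ContinuousOn (fun t => x t i) (Ici 0) := fun i => (hx i).1
  -- The disturbance may be discontinuous, but it is absent at `i`, so the input there is continuous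
  -- as passivity requires.
  have hu : ContinuousOn (fun t => couplingInput g α (fun j => S.C *ᵥ x t j) i + d t i) (Ici 0) := by
    simpa [hd] using couplingInput_continuousOn g α hc i
  have hp := hS _ _ hu (hx i) T hT
  have hdot : ∀ j k, ContinuousOn (fun t => (S.C *ᵥ x t j) ⬝ᵥ (S.C *ᵥ x t k)) (Ici 0) := by
    intro j k
    exact continuousOn_finsetSum _ fun r _ =>
      ((continuous_apply r).comp_continuousOn (hx.output_continuousOn j)).mul
        ((continuous_apply r).comp_continuousOn (hx.output_continuousOn k))
  have hint : ∀ j k, IntervalIntegrable (fun t => (S.C *ᵥ x t j) ⬝ᵥ (S.C *ᵥ x t k)) volume 0 T :=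
    fun j k => ((hdot j k).mono (by rw [uIcc_of_le hT]; exact Icc_subset_Ici_self)).intervalIntegrable
  set f : ℝ → ℝ := fun t => ∑ j ∈ Finset.univ.erase i, α * g i j *
    ((S.C *ᵥ x t j) ⬝ᵥ (S.C *ᵥ x t j) - (S.C *ᵥ x t i) ⬝ᵥ (S.C *ᵥ x t i)) with hf
  have hfint : ∫ t in (0 : ℝ)..T, f t =
      ∑ j ∈ Finset.univ.erase i, α * g i j * (energy S x T j - energy S x T i) := by
    rw [intervalIntegral.integral_finsetSum fun j _ => ((hint j j).sub (hint i i)).const_mul _]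
    refine Finset.sum_congr rfl fun j _ => ?_
    rw [intervalIntegral.integral_const_mul, intervalIntegral.integral_sub (hint j j) (hint i i)]
    rfl
  have hfc : ContinuousOn f (Ici 0) := continuousOn_finsetSum _ fun j _ =>
    ((hdot j j).sub (hdot i i)).const_smul (α * g i j)
  have hIcc : uIcc 0 T ⊆ Ici 0 := by rw [uIcc_of_le hT]; exact Icc_subset_Ici_self
  have huy : ContinuousOn (fun t => (couplingInput g α (fun j => S.C *ᵥ x t j) i + d t i) ⬝ᵥ
      (S.C *ᵥ x t i)) (Ici 0) := continuousOn_finsetSum _ fun r _ =>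
    ((continuous_apply r).comp_continuousOn hu).mul
      ((continuous_apply r).comp_continuousOn (hx.output_continuousOn i))
  have hle : ∀ t, (couplingInput g α (fun j => S.C *ᵥ x t j) i + d t i) ⬝ᵥ (S.C *ᵥ x t i) ≤
      2⁻¹ * f t := by
    intro t
    simp only [hf, hd, add_zero, couplingInput, Finset.smul_sum, smul_smul, sum_dotProduct,
      smul_dotProduct, Finset.mul_sum]
    refine Finset.sum_le_sum fun j hj => ?_
    have h1 : 0 ≤ α * g i j := mul_nonneg hα (hg i j (Finset.ne_of_mem_erase hj).symm)
    have h2 : 0 ≤ (S.C *ᵥ x t j - S.C *ᵥ x t i) ⬝ᵥ (S.C *ᵥ x t j - S.C *ᵥ x t i) :=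
      Finset.sum_nonneg fun _ _ => mul_self_nonneg _
    rw [sub_dotProduct, dotProduct_sub, dotProduct_sub,
      dotProduct_comm (S.C *ᵥ x t i) (S.C *ᵥ x t j)] at h2
    rw [sub_dotProduct, smul_eq_mul]
    nlinarith
  have := hp.trans (intervalIntegral.integral_mono_on hT (huy.mono hIcc).intervalIntegrable
    ((hfc.mono hIcc).intervalIntegrable.const_mul _) fun t _ => hle t)
  rw [intervalIntegral.integral_const_mul, hfint] at this
  linarith

/-- In a network of passive subsystems the output energies beyond a separating cutset do not exceed
the largest energy on the cutset. -/
theorem energy_le_sup'_of_isPassive {S : Subsystem n m} (hS : S.IsPassive)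
    {g : Matrix (Fin N) (Fin N) ℝ} (hg : ∀ i j, i ≠ j → 0 ≤ g i j) {α : ℝ} (hα : 0 ≤ α)
    {s : Fin N} {w : ℝ → Fin m → ℝ} {x : ℝ → Fin N → Fin n → ℝ}
    (hx : IsTrajectory S g α 0 (fun t => Pi.single s (w t)) x)
    {V₁ VC VB : Finset (Fin N)} (hVC : VC.Nonempty) (hcut : IsSeparatingCutset g s V₁ VC VB)
    {T : ℝ} (hT : 0 < T) {b : Fin N} (hb : b ∈ VB) :
    energy S x T b ≤ VC.sup' hVC (energy S x T) := by
  obtain ⟨h1C, h1B, hCB, hunion, hedge, hs⟩ := hcut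
  by_contra! hlt
  obtain ⟨a, haB, hmax⟩ := VB.exists_max_image (energy S x T) ⟨b, hb⟩
  -- At a vertex of `W` every term of the energy balance is nonpositive while the sum is
  -- nonnegative. Hence all terms vanish, and so does any coupling from outside `W`.
  set W := VB.filter fun i => energy S x T i = energy S x T a with hWdef
  have hWB : ∀ i ∈ W, i ∈ VB := fun i hi => (Finset.mem_filter.1 hi).1
  have hC : ∀ c ∈ VC, energy S x T c < energy S x T a := fun c hc =>
    ((Finset.le_sup' (energy S x T) hc).trans_lt hlt).trans_le (hmax b hb)
  have hd : ∀ i ∈ W, ∀ t, Pi.single (M := fun _ : Fin N => Fin m → ℝ) s (w t) i = 0 := by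
    intro i hi t
    refine Pi.single_eq_of_ne ?_ _
    rintro rfl
    rcases Finset.mem_union.1 hs with h | h
    · exact Finset.disjoint_left.1 h1B h (hWB _ hi)
    · exact Finset.disjoint_left.1 hCB h (hWB _ hi)
  have hW : ∀ i ∈ W, ∀ j ∉ W, α * g i j = 0 := by
    intro i hi j hj
    have hij : j ≠ i := fun h => hj (h ▸ hi)
    have hEi : energy S x T i = energy S x T a := (Finset.mem_filter.1 hi).2
    have hcases : ∀ k, k ≠ i → g i k = 0 ∨ energy S x T k ≤ energy S x T a := by
      intro k hk
      have hk' : k ∈ V₁ ∪ VC ∪ VB := hunion ▸ Finset.mem_univ k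
      rcases Finset.mem_union.1 hk' with h | h
      · rcases Finset.mem_union.1 h with h | h
        · exact Or.inl (le_antisymm (not_lt.1 (hedge k h i (hWB i hi))) (hg i k hk.symm))
        · exact Or.inr (hC k h).le
      · exact Or.inr (hmax k h)
    have hterm : ∀ k ∈ Finset.univ.erase i,
        α * g i k * (energy S x T k - energy S x T i) ≤ 0 := by
      intro k hk
      have hk := Finset.ne_of_mem_erase hk
      rcases hcases k hk with h | h
      · simp [h]
      · exact mul_nonpos_of_nonneg_of_nonpos (mul_nonneg hα (hg i k hk.symm))
          (by rw [hEi]; linarith)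
    have hsum := le_antisymm (Finset.sum_nonpos hterm)
      (hx.sum_energy_sub_nonneg hS hg hα (hd i hi) hT.le)
    have hz := (Finset.sum_eq_zero_iff_of_nonpos hterm).1 hsum j
      (Finset.mem_erase.2 ⟨hij, Finset.mem_univ j⟩)
    rcases mul_eq_zero.1 hz with h | h
    · exact h
    · rw [hEi, sub_eq_zero] at h
      have hjB : j ∉ VB := fun hjB => hj (Finset.mem_filter.2 ⟨hjB, h⟩)
      have hjC : j ∉ VC := fun hjC => (hC j hjC).ne h
      have hj' : j ∈ V₁ ∪ VC ∪ VB := hunion ▸ Finset.mem_univ j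
      have hj1 : j ∈ V₁ := by simpa [hjB, hjC] using hj'
      have := le_antisymm (not_lt.1 (hedge j hj1 i (hWB i hi))) (hg i j hij.symm)
      rw [this, mul_zero]
  have hEa : energy S x T a = 0 := by
    have : ∫ t in (0 : ℝ)..T, (S.C *ᵥ x t a) ⬝ᵥ (S.C *ᵥ x t a) = ∫ t in (0 : ℝ)..T, (0 : ℝ) := by
      refine intervalIntegral.integral_congr fun t ht => ?_
      rw [uIcc_of_le hT.le] at ht
      have := hx.eq_zero_of_isolated hd hW (Finset.mem_filter.2 ⟨haB, rfl⟩) ht.1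
      simp [this]
    rw [energy, this]
    simp
  obtain ⟨c, hc⟩ := hVC
  exact absurd (hC c hc) (not_lt.2 (hEa ▸ energy_nonneg S x hT.le c))

end Network

theorem corollary2 {N n : ℕ} (S : Subsystem n 1)
    (hS : S.IsPassive ∨ S.NyquistInClosedRightHalfPlane)
    (g : Matrix (Fin N) (Fin N) ℝ) (hg : ∀ i j, i ≠ j → 0 ≤ g i j)
    (α : ℝ) (hα : 0 ≤ α)
    (hsync : Network.SyncAsymptoticallyStable S g α) :
    Network.PropagationStable S g α := by
  refine ⟨hsync, fun s w x _ hx V₁ VC VB hVC hcut T hT b hb => ?_⟩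
  have hpassive : S.IsPassive := by
    rcases hS with h | h
    · exact h
    · obtain ⟨c, hc⟩ := hVC
      -- Two distinct vertices are needed for a nonzero zero-sum eigenvector; with a single
      -- subsystem, synchronization carries no information.
      have hbc : b ≠ c := by
        rintro rfl
        exact Finset.disjoint_left.1 hcut.2.2.1 hc hb
      obtain ⟨μ, hμ, hstab⟩ := hsync.exists_stabilizing_feedback hg hα hbc
      exact h.isPassive hμ hstab
  exact Network.energy_le_sup'_of_isPassive hpassive hg hα hx hVC hcut hT hb
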